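/- Let $G$ be a finite simple graph with $n$ vertices, $e$ edges, smallest degree $\delta_m\ge 1$ (no isolated vertices) and largest degree $\delta_M$, and suppose $2e\ge n$. Let $d_i$ be the degree of vertex $i$, and let $A_{ex}(G)$ be the real symmetric $n\times n$ matrix whose $(i,j)$ entry is $\frac12\left(\frac{d_i}{d_j}+\frac{d_j}{d_i}\right)$ if $i$ and $j$ are adjacent and $0$ otherwise. Let $\varepsilon_{ex}(G)=\sum_{j=1}^n|\eta_j|$, where $\eta_1,\dots,\eta_n$ are the eigenvalues of $A_{ex}(G)$ counted with multiplicity. Then $$\varepsilon_{ex}(G)\le \frac12\left(\frac{\delta_M}{\delta_m}+\frac{\delta_m}{\delta_M}\right)\left(\frac{2e}{n}+\sqrt{(n-1)\left[2e-\left(\frac{2e}{n}\right)^2\right]}\right).$$ Equality holds if and only if at least one of the following is true: (i) $n$ is even and $G\cong\frac n2K_2$, the disjoint union of $n/2$ copies of $K_2$; (ii) $G\cong K_n$; (iii) $G$ is a strongly regular graph (neither complete nor edgeless) whose set of non-trivial eigenvalues, i.e. eigenvalues of the adjacency matrix having an eigenvector orthogonal to the all-ones vector, is $\left\{\sqrt{\frac{2e-(2e/n)^2}{n-1}},\,-\sqrt{\frac{2e-(2e/n)^2}{n-1}}\right\}$.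 -/

import Mathlib

namespace SimpleGraph

/-- The extended adjacency matrix of a finite simple graph: the `(i, j)` entry is
`(d_i / d_j + d_j / d_i) / 2` if `i` and `j` are adjacent, and `0` otherwise.
(Both degrees are positive whenever `i` and `j` are adjacent.) -/
noncomputable def extAdjMatrix {V : Type*} [Fintype V] (G : SimpleGraph V)
    [DecidableRel G.Adj] : Matrix V V ℝ :=
  Matrix.of fun i j =>
    if G.Adj i j then
      (1 / 2 : ℝ) * ((G.degree i : ℝ) / (G.degree j : ℝ) + (G.degree j : ℝ) / (G.degree i : ℝ))
    else 0

theorem extAdjMatrix_isHermitian {V : Type*} [Fintype V] (G : SimpleGraph V)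
    [DecidableRel G.Adj] : G.extAdjMatrix.IsHermitian := by
  ext i j
  simp [extAdjMatrix, Matrix.conjTranspose_apply, G.adj_comm j i,
    add_comm ((G.degree j : ℝ) / (G.degree i : ℝ))]

/-- The extended energy: the sum of the absolute values of the eigenvalues, counted with
multiplicity, of the extended adjacency matrix. -/
noncomputable def extEnergy {V : Type*} [Fintype V] [DecidableEq V] (G : SimpleGraph V)
    [DecidableRel G.Adj] : ℝ :=
  ∑ i, |G.extAdjMatrix_isHermitian.eigenvalues i|

/-- The disjoint union of `m` copies of `H`. -/
def disjointCopies {W : Type*} (m : ℕ) (H : SimpleGraph W) : SimpleGraph (Fin m × W) where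
  Adj x y := x.1 = y.1 ∧ H.Adj x.2 y.2
  symm := ⟨fun _ _ h => ⟨h.1.symm, h.2.symm⟩⟩
  loopless := ⟨fun _ h => H.irrefl h.2⟩

/-- `G` is strongly regular (for some parameters); as usual, complete graphs and edgeless graphs
are not counted as strongly regular. -/
def IsStronglyRegular {V : Type*} [Fintype V] (G : SimpleGraph V) [DecidableRel G.Adj] : Prop :=
  G ≠ ⊤ ∧ G ≠ ⊥ ∧ ∃ k l m : ℕ, G.IsSRGWith (Fintype.card V) k l m

/-- The set of non-trivial eigenvalues of a regular graph: the eigenvalues of its adjacency matrix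
that have an eigenvector orthogonal to the all-ones vector. -/
def nontrivialEigenvalues {V : Type*} [Fintype V] (G : SimpleGraph V) [DecidableRel G.Adj] :
    Set ℝ :=
  {t | ∃ v : V → ℝ, v ≠ 0 ∧ ∑ i, v i = 0 ∧ (G.adjMatrix ℝ).mulVec v = t • v}

end SimpleGraph

section

open Matrix

theorem Matrix.IsHermitian.exists_orthonormal_eigenvectors {V : Type*} [Fintype V] [DecidableEq V]
    {M : Matrix V V ℝ} (hM : M.IsHermitian) :
    ∃ w : V → V → ℝ, (∀ k, M *ᵥ w k = hM.eigenvalues k • w k) ∧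
      (∀ k, w k ⬝ᵥ w k = 1) ∧
      (∀ x y, ∑ k, (w k ⬝ᵥ x) * (w k ⬝ᵥ y) = x ⬝ᵥ y) := by
  refine ⟨fun k => hM.eigenvectorBasis k, fun k => hM.mulVec_eigenvectorBasis k, fun k => ?_,
    fun x y => ?_⟩
  · have h := hM.eigenvectorBasis.orthonormal.1 k
    have h2 := EuclideanSpace.real_norm_sq_eq (hM.eigenvectorBasis k)
    rw [h] at h2
    simp only [dotProduct]
    rw [← Finset.sum_congr rfl (fun i _ => pow_two _), ← h2]
    norm_num
  · have h := hM.eigenvectorBasis.sum_inner_mul_inner (WithLp.toLp 2 x) (WithLp.toLp 2 y)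
    simp only [EuclideanSpace.inner_eq_star_dotProduct, star_trivial] at h
    rw [dotProduct_comm x y, ← h]
    refine Finset.sum_congr rfl fun k _ => ?_
    rw [dotProduct_comm _ y]

theorem Matrix.IsHermitian.dotProduct_mulVec_comm {V : Type*} [Fintype V]
    {M : Matrix V V ℝ} (hM : M.IsHermitian) (x y : V → ℝ) :
    x ⬝ᵥ M *ᵥ y = (M *ᵥ x) ⬝ᵥ y := by
  have h : Mᵀ = M := by simpa [conjTranspose_eq_transpose_of_trivial] using hM.eq
  rw [dotProduct_mulVec, ← mulVec_transpose, h]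

theorem Matrix.IsHermitian.dotProduct_mulVec_eq_sum {V : Type*} [Fintype V]
    {M : Matrix V V ℝ} (hM : M.IsHermitian) {l : V → ℝ} {w : V → V → ℝ}
    (hw : ∀ k, M *ᵥ w k = l k • w k)
    (hp : ∀ x y, ∑ k, (w k ⬝ᵥ x) * (w k ⬝ᵥ y) = x ⬝ᵥ y) (x y : V → ℝ) :
    x ⬝ᵥ M *ᵥ y = ∑ k, l k * (w k ⬝ᵥ x) * (w k ⬝ᵥ y) := by
  rw [← hp]
  refine Finset.sum_congr rfl fun k _ => ?_
  rw [hM.dotProduct_mulVec_comm (w k) y, hw, smul_dotProduct, smul_eq_mul]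
  ring

theorem Matrix.IsHermitian.mulVec_dotProduct_mulVec_eq_sum {V : Type*} [Fintype V]
    {M : Matrix V V ℝ} (hM : M.IsHermitian) {l : V → ℝ} {w : V → V → ℝ}
    (hw : ∀ k, M *ᵥ w k = l k • w k)
    (hp : ∀ x y, ∑ k, (w k ⬝ᵥ x) * (w k ⬝ᵥ y) = x ⬝ᵥ y) (x y : V → ℝ) :
    (M *ᵥ x) ⬝ᵥ (M *ᵥ y) = ∑ k, l k ^ 2 * (w k ⬝ᵥ x) * (w k ⬝ᵥ y) := by
  rw [← hp]
  refine Finset.sum_congr rfl fun k _ => ?_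
  rw [hM.dotProduct_mulVec_comm (w k) y, hM.dotProduct_mulVec_comm (w k) x, hw, smul_dotProduct,
    smul_dotProduct, smul_eq_mul, smul_eq_mul]
  ring

theorem Matrix.IsHermitian.sum_sq_eigenvalues {V : Type*} [Fintype V] [DecidableEq V]
    {M : Matrix V V ℝ} (hM : M.IsHermitian) :
    ∑ k, hM.eigenvalues k ^ 2 = ∑ i, ∑ j, M i j ^ 2 := by
  obtain ⟨w, hw, h1, hp⟩ := hM.exists_orthonormal_eigenvectors
  have h := fun j => hM.mulVec_dotProduct_mulVec_eq_sum hw hp (Pi.single j 1) (Pi.single j 1)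
  rw [Finset.sum_comm]
  calc _ = ∑ k, hM.eigenvalues k ^ 2 * (w k ⬝ᵥ w k) := by simp [h1]
    _ = ∑ j, ∑ k, hM.eigenvalues k ^ 2 * w k j * w k j := by
      rw [Finset.sum_comm]
      simp only [dotProduct, Finset.mul_sum, mul_assoc]
    _ = _ := by
      refine Finset.sum_congr rfl fun j _ => ?_
      have := h j
      simp only [dotProduct_single_one, mulVec_single_one] at this
      rw [← this]
      simp [dotProduct, pow_two]

theorem Matrix.IsHermitian.eigenvalues_congr {V : Type*} [Fintype V] [DecidableEq V]
    {M N : Matrix V V ℝ} (hM : M.IsHermitian) (hN : N.IsHermitian) (h : M = N) :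
    hM.eigenvalues = hN.eigenvalues := by
  subst h; rfl

namespace SimpleGraph

theorem isHermitian_adjMatrix_real {V : Type*} (G : SimpleGraph V) [DecidableRel G.Adj] : (G.adjMatrix ℝ).IsHermitian := by
  rw [Matrix.IsHermitian, conjTranspose_eq_transpose_of_trivial, transpose_adjMatrix]

variable {V : Type*} [Fintype V] [DecidableEq V] (G : SimpleGraph V) [DecidableRel G.Adj]

/-- The energy of a graph: the sum of the absolute values of its eigenvalues. -/
noncomputable def energy : ℝ := ∑ i, |G.isHermitian_adjMatrix_real.eigenvalues i|

/-- The extended energy is at most the energy times the largest possible value of an entry of the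
extended adjacency matrix. -/
theorem extEnergy_le_mul_energy (hmin : G.minDegree ≠ 0) :
    G.extEnergy ≤ (1 / 2 : ℝ) * ((G.maxDegree : ℝ) / (G.minDegree : ℝ)
            + (G.minDegree : ℝ) / (G.maxDegree : ℝ)) * G.energy := by
  obtain ⟨z, hz, hz1, hzp⟩ := G.extAdjMatrix_isHermitian.exists_orthonormal_eigenvectors
  obtain ⟨w, hw, hw1, hwp⟩ := G.isHermitian_adjMatrix_real.exists_orthonormal_eigenvectors
  unfold extEnergy energy
  set l := G.isHermitian_adjMatrix_real.eigenvalues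
  set η := G.extAdjMatrix_isHermitian.eigenvalues
  have hm0 : (0 : ℝ) < G.minDegree := by exact_mod_cast Nat.pos_of_ne_zero hmin
  have hm : ∀ i, (G.minDegree : ℝ) ≤ G.degree i := fun i => by exact_mod_cast G.minDegree_le_degree i
  have hM : ∀ i, (G.degree i : ℝ) ≤ G.maxDegree := fun i => by exact_mod_cast G.degree_le_maxDegree i
  set m : ℝ := (G.minDegree : ℝ)
  set M : ℝ := (G.maxDegree : ℝ)
  set c := (1 / 2 : ℝ) * (M / m + m / M) with hc
  rcases isEmpty_or_nonempty V with hV | ⟨⟨v⟩⟩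
  · simp
  have hM0 : 0 < M := hm0.trans_le ((hm v).trans (hM v))
  set r := Real.sqrt (m * M)
  have hr : 0 < r := Real.sqrt_pos.2 (by positivity)
  have hr2 : r ^ 2 = m * M := Real.sq_sqrt (by positivity)
  set D : V → ℝ := fun i => G.degree i / r with hD
  have hd0 : ∀ i, (0 : ℝ) < G.degree i := fun i => hm0.trans_le (hm i)
  have hD0 : ∀ i, 0 < D i := fun i => div_pos (hd0 i) hr
  -- the quadratic form of the extended adjacency matrix
  have hq : ∀ x : V → ℝ, x ⬝ᵥ G.extAdjMatrix *ᵥ x =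
      (fun i => D i * x i) ⬝ᵥ (G.adjMatrix ℝ) *ᵥ (fun i => (D i)⁻¹ * x i) := by
    intro x
    have e1 : ∀ M : Matrix V V ℝ, ∀ y z : V → ℝ, y ⬝ᵥ M *ᵥ z = ∑ i, ∑ j, y i * M i j * z j := by
      intro M y z
      simp [dotProduct, mulVec, Finset.mul_sum, mul_assoc]
    rw [e1, e1]
    have e2 : ∑ i, ∑ j, D i * x i * G.adjMatrix ℝ i j * ((D j)⁻¹ * x j) =
      ∑ i, ∑ j, D j * x j * G.adjMatrix ℝ i j * ((D i)⁻¹ * x i) := by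
      rw [Finset.sum_comm]
      simp only [adjMatrix_apply, G.adj_comm]
    have e3 : ∀ i j, x i * G.extAdjMatrix i j * x j =
        (D i * x i * G.adjMatrix ℝ i j * ((D j)⁻¹ * x j) +
          D j * x j * G.adjMatrix ℝ i j * ((D i)⁻¹ * x i)) / 2 := by
      intro i j
      have := hd0 i
      have := hd0 j
      simp only [extAdjMatrix, adjMatrix_apply, of_apply, hD]
      split_ifs
      · field_simp
      · simp
    simp only [e3, ← Finset.sum_div, Finset.sum_add_distrib]
    rw [← e2]; ring
  have hη : ∀ j, |η j| ≤ ∑ k, |l k| * (((z j ⬝ᵥ fun i => D i * w k i) * (z j ⬝ᵥ fun i => D i * w k i) +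
      (z j ⬝ᵥ fun i => (D i)⁻¹ * w k i) * (z j ⬝ᵥ fun i => (D i)⁻¹ * w k i)) / 2) := by
    intro j
    have h1 : η j = z j ⬝ᵥ G.extAdjMatrix *ᵥ z j := by
      rw [hz, dotProduct_smul, hz1]; simp [η]
    rw [h1, hq, G.isHermitian_adjMatrix_real.dotProduct_mulVec_eq_sum hw hwp]
    refine (Finset.abs_sum_le_sum_abs _ _).trans (Finset.sum_le_sum fun k _ => ?_)
    have s1 : ∀ F : V → ℝ, (w k ⬝ᵥ fun i => F i * z j i) = z j ⬝ᵥ fun i => F i * w k i := by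
      intro F
      simp only [dotProduct]
      exact Finset.sum_congr rfl fun i _ => by ring
    rw [s1, s1 (fun i => (D i)⁻¹), mul_assoc, abs_mul]
    refine mul_le_mul_of_nonneg_left ?_ (abs_nonneg _)
    rw [abs_le]
    constructor
    · nlinarith [sq_nonneg ((z j ⬝ᵥ fun i => D i * w k i) + (z j ⬝ᵥ fun i => (D i)⁻¹ * w k i))]
    · nlinarith [sq_nonneg ((z j ⬝ᵥ fun i => D i * w k i) - (z j ⬝ᵥ fun i => (D i)⁻¹ * w k i))]
  refine (Finset.sum_le_sum fun j _ => hη j).trans ?_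
  rw [Finset.sum_comm, Finset.mul_sum]
  refine Finset.sum_le_sum fun k _ => ?_
  rw [← Finset.mul_sum, mul_comm c]
  refine mul_le_mul_of_nonneg_left ?_ (abs_nonneg _)
  rw [← Finset.sum_div, Finset.sum_add_distrib, hzp, hzp]
  calc _ = ∑ i, (D i ^ 2 + (D i ^ 2)⁻¹) / 2 * (w k i * w k i) := by
        simp only [dotProduct, ← Finset.sum_add_distrib, Finset.sum_div]
        refine Finset.sum_congr rfl fun i _ => ?_
        have := hD0 i
        field_simp
    _ ≤ ∑ i, c * (w k i * w k i) := by
        refine Finset.sum_le_sum fun i _ => mul_le_mul_of_nonneg_right ?_ (mul_self_nonneg _)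
        have h1 := hm i
        have h2 := hM i
        have h3 := hd0 i
        have e : D i ^ 2 = (G.degree i : ℝ) ^ 2 / (m * M) := by rw [hD, ← hr2]; field_simp
        have h4 : m ^ 2 ≤ (G.degree i : ℝ) ^ 2 := by gcongr
        have h5 : (G.degree i : ℝ) ^ 2 ≤ M ^ 2 := by gcongr
        rw [e, hc]
        set q := (G.degree i : ℝ) ^ 2
        have hq0 : 0 < q := by positivity
        have : (1 / 2 : ℝ) * (M / m + m / M) - (q / (m * M) + (q / (m * M))⁻¹) / 2 =
          (M ^ 2 - q) * (q - m ^ 2) / (2 * m * M * q) := by field_simp; ring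
        have h6 : 0 ≤ (M ^ 2 - q) * (q - m ^ 2) / (2 * m * M * q) :=
          div_nonneg (mul_nonneg (sub_nonneg.2 h5) (sub_nonneg.2 h4)) (by positivity)
        linarith
    _ = c := by
        rw [← Finset.mul_sum]
        have := hw1 k
        simp only [dotProduct] at this
        rw [this, mul_one]

theorem sum_sq_eigenvalues_adjMatrix :
    ∑ k, G.isHermitian_adjMatrix_real.eigenvalues k ^ 2 = ∑ i, (G.degree i : ℝ) := by
  rw [Matrix.IsHermitian.sum_sq_eigenvalues]
  refine Finset.sum_congr rfl fun i _ => ?_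
  simp [adjMatrix_apply, ← card_neighborFinset_eq_degree, neighborFinset_eq_filter]

theorem adjMatrix_mulVec_one {V : Type*} [Fintype V] (G : SimpleGraph V) [DecidableRel G.Adj]
    (i : V) :
    ((G.adjMatrix ℝ) *ᵥ (fun _ => 1)) i = G.degree i := by
  simp [adjMatrix_mulVec_apply]

/-- The Koolen–Moulton bound on the energy, with the structure of the square of the adjacency
matrix in the case of equality. -/
theorem energy_le_and_eq_imp [Nonempty V] {a s : ℝ}
    (hsum : ∑ i, (G.degree i : ℝ) = Fintype.card V * a) (hs : 0 < s) (hsa : s ≤ a)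
    (hsq : ((Fintype.card V : ℝ) - 1) * s ^ 2 = Fintype.card V * a - a ^ 2) :
    G.energy ≤ a + ((Fintype.card V : ℝ) - 1) * s ∧
    (G.energy = a + ((Fintype.card V : ℝ) - 1) * s →
      (∀ i, (G.degree i : ℝ) = a) ∧
      ∀ x y : V → ℝ, (G.adjMatrix ℝ *ᵥ x) ⬝ᵥ (G.adjMatrix ℝ *ᵥ y) =
        s ^ 2 * (x ⬝ᵥ y) + (a ^ 2 - s ^ 2) / Fintype.card V * ((∑ i, x i) * ∑ i, y i)) := by
  obtain ⟨w, hw, hw1, hwp⟩ := G.isHermitian_adjMatrix_real.exists_orthonormal_eigenvectors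
  have hl2 := G.sum_sq_eigenvalues_adjMatrix
  have hform := G.isHermitian_adjMatrix_real.dotProduct_mulVec_eq_sum hw hwp
  have hform2 := G.isHermitian_adjMatrix_real.mulVec_dotProduct_mulVec_eq_sum hw hwp
  unfold energy
  set l := G.isHermitian_adjMatrix_real.eigenvalues
  set n : ℝ := (Fintype.card V : ℝ) with hn
  have hn0 : 0 < n := by rw [hn]; exact_mod_cast Fintype.card_pos
  obtain ⟨k₀, hk₀⟩ := Finite.exists_max l
  set p : V → ℝ := fun k => w k ⬝ᵥ fun _ => 1 with hp
  have hp2 : ∑ k, p k * p k = n := by rw [hp, hwp]; simp [dotProduct, hn]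
  have hlp : ∑ k, l k * (p k * p k) = n * a := by
    simp only [← mul_assoc]
    rw [hp, ← hform, ← hsum]
    simp only [dotProduct, adjMatrix_mulVec_one, one_mul]
  have hax : a ≤ l k₀ := by
    have : n * a ≤ n * l k₀ := by
      rw [← hlp, ← hp2, Finset.sum_mul]
      refine Finset.sum_le_sum fun k _ => ?_
      rw [mul_comm (p k * p k)]
      exact mul_le_mul_of_nonneg_right (hk₀ k) (mul_self_nonneg _)
    exact le_of_mul_le_mul_left this hn0
  set x := l k₀
  have hE : ∑ k, |l k| = x + ∑ k ∈ Finset.univ.erase k₀, |l k| := by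
    rw [← Finset.add_sum_erase _ _ (Finset.mem_univ k₀), abs_of_pos (by linarith)]
  have hS : n * a = x ^ 2 + ∑ k ∈ Finset.univ.erase k₀, l k ^ 2 := by
    rw [← hsum, ← hl2, ← Finset.add_sum_erase _ _ (Finset.mem_univ k₀)]
  have hcard : (((Finset.univ.erase k₀).card : ℕ) : ℝ) = n - 1 := by
    rw [Finset.card_erase_of_mem (Finset.mem_univ _), Finset.card_univ,
      Nat.cast_sub Fintype.card_pos, Nat.cast_one]
  have hdefect : a + (n - 1) * s - ∑ k, |l k| = (x - a) * (x + a - 2 * s) / (2 * s) +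
      ∑ k ∈ Finset.univ.erase k₀, (|l k| - s) ^ 2 / (2 * s) := by
    have h1 : ∑ k ∈ Finset.univ.erase k₀, (|l k| - s) ^ 2 / (2 * s) =
        ((n * a - x ^ 2) + (n - 1) * s ^ 2) / (2 * s) - ∑ k ∈ Finset.univ.erase k₀, |l k| := by
      rw [hS, ← hcard, ← nsmul_eq_mul, ← Finset.sum_const, add_sub_cancel_left,
        ← Finset.sum_add_distrib, Finset.sum_div, ← Finset.sum_sub_distrib]
      refine Finset.sum_congr rfl fun k _ => ?_
      rw [← sq_abs (l k)]
      field_simp; ring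
    rw [h1, hE]
    have h2 : n * a = (n - 1) * s ^ 2 + a ^ 2 := by linarith
    rw [h2]
    field_simp; ring
  have hd1 : 0 ≤ (x - a) * (x + a - 2 * s) / (2 * s) :=
    div_nonneg (mul_nonneg (by linarith) (by linarith)) (by linarith)
  have hd2 : ∀ k ∈ Finset.univ.erase k₀, 0 ≤ (|l k| - s) ^ 2 / (2 * s) := fun k _ => by positivity
  have hd3 := Finset.sum_nonneg hd2
  refine ⟨by linarith, fun heq => ?_⟩
  have hz1 : (x - a) * (x + a - 2 * s) / (2 * s) = 0 := by linarith
  have hz2 : ∑ k ∈ Finset.univ.erase k₀, (|l k| - s) ^ 2 / (2 * s) = 0 := by linarith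
  have habs : ∀ k, k ≠ k₀ → |l k| = s := by
    intro k hk
    have := (Finset.sum_eq_zero_iff_of_nonneg hd2).1 hz2 k (by simp [hk])
    have h2s : 2 * s ≠ 0 := by positivity
    have := pow_eq_zero_iff (two_ne_zero) |>.1 ((div_eq_zero_iff.1 this).resolve_right h2s)
    linarith
  have hxa : x = a := by
    have h2s : 2 * s ≠ 0 := by positivity
    rcases mul_eq_zero.1 ((div_eq_zero_iff.1 hz1).resolve_right h2s) with h | h <;> linarith
  have hpl : ∀ k, p k ≠ 0 → l k = a := by
    have h0 : ∑ k, (a - l k) * (p k * p k) = 0 := by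
      simp only [sub_mul, Finset.sum_sub_distrib, hlp, ← Finset.mul_sum, hp2]; ring
    have hnn : ∀ k ∈ Finset.univ, 0 ≤ (a - l k) * (p k * p k) := fun k _ =>
      mul_nonneg (by have := hk₀ k; linarith) (mul_self_nonneg _)
    intro k hk
    have := (Finset.sum_eq_zero_iff_of_nonneg hnn).1 h0 k (Finset.mem_univ _)
    have := (mul_eq_zero.1 this).resolve_right (mul_self_ne_zero.2 hk)
    linarith
  have hsum1 : ∀ y : V → ℝ, ∑ k, (w k ⬝ᵥ y) * p k = ∑ i, y i := by
    intro y
    rw [hp, hwp]; simp [dotProduct]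
  refine ⟨fun i => ?_, fun y z => ?_⟩
  · have h := hform (Pi.single i 1) (fun _ => 1)
    rw [single_one_dotProduct, adjMatrix_mulVec_one] at h
    rw [h]
    calc _ = ∑ k, a * ((w k ⬝ᵥ Pi.single i 1) * p k) := by
          refine Finset.sum_congr rfl fun k _ => ?_
          by_cases hk : p k = 0
          · simp only [hp] at hk
            simp [hp, hk]
          · rw [hpl k hk]; ring
      _ = a := by rw [← Finset.mul_sum, hsum1]; simp
  · have h1 : (G.adjMatrix ℝ *ᵥ y) ⬝ᵥ (G.adjMatrix ℝ *ᵥ z) =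
        s ^ 2 * (y ⬝ᵥ z) + (a ^ 2 - s ^ 2) * ((w k₀ ⬝ᵥ y) * (w k₀ ⬝ᵥ z)) := by
      rw [hform2, ← hwp y z, ← Finset.add_sum_erase _ _ (Finset.mem_univ k₀),
        ← Finset.add_sum_erase _ _ (Finset.mem_univ k₀), mul_add, Finset.mul_sum,
        show l k₀ = a from hxa]
      have : ∑ k ∈ Finset.univ.erase k₀, l k ^ 2 * (w k ⬝ᵥ y) * (w k ⬝ᵥ z) =
          ∑ k ∈ Finset.univ.erase k₀, s ^ 2 * ((w k ⬝ᵥ y) * (w k ⬝ᵥ z)) := by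
        refine Finset.sum_congr rfl fun k hk => ?_
        rw [← sq_abs, habs k (Finset.ne_of_mem_erase hk)]; ring
      rw [this]; ring
    rw [h1]
    by_cases has : a = s
    · simp [has]
    · have hp0 : ∀ k, k ≠ k₀ → p k = 0 := by
        intro k hk
        by_contra h
        have h1 := habs k hk
        rw [hpl k h, abs_of_pos (by linarith)] at h1
        exact has h1
      have hone : ∀ y : V → ℝ, ∑ i, y i = (w k₀ ⬝ᵥ y) * p k₀ := by
        intro y
        rw [← hsum1 y, Finset.sum_eq_single k₀ (fun k _ hk => by rw [hp0 k hk, mul_zero]) (by simp)]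
      have hpn : p k₀ * p k₀ = n := by
        rw [← hp2, Finset.sum_eq_single k₀ (fun k _ hk => by rw [hp0 k hk, mul_zero]) (by simp)]
      rw [hone y, hone z, ← hpn]
      have : p k₀ ≠ 0 := fun h => hn0.ne' (by rw [← hpn, h, mul_zero])
      field_simp

/-- The energy of a regular graph whose non-trivial eigenvalues have the same absolute value. -/
theorem energy_eq_of_nontrivialEigenvalues {a s : ℝ}
    (hreg : ∀ i, (G.degree i : ℝ) = a) (hs : 0 < s) (ha : 0 ≤ a)
    (hsq : ((Fintype.card V : ℝ) - 1) * s ^ 2 = Fintype.card V * a - a ^ 2)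
    (ht : ∀ t ∈ G.nontrivialEigenvalues, |t| = s) :
    G.energy = a + ((Fintype.card V : ℝ) - 1) * s := by
  obtain ⟨w, hw, hw1, hwp⟩ := G.isHermitian_adjMatrix_real.exists_orthonormal_eigenvectors
  have hl2 := G.sum_sq_eigenvalues_adjMatrix
  unfold energy
  set l := G.isHermitian_adjMatrix_real.eigenvalues
  have hone : (G.adjMatrix ℝ) *ᵥ (fun _ => 1) = fun _ => a := by
    funext i; rw [adjMatrix_mulVec_one, hreg]
  have hroot : ∀ k, l k ^ 2 - (a + s) * |l k| + a * s = 0 := by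
    intro k
    have hor : |l k| = a ∨ |l k| = s := by
      by_cases h0 : ∑ i, w k i = 0
      · refine Or.inr (ht _ ⟨w k, fun h => ?_, h0, hw k⟩)
        have := hw1 k
        simp [h] at this
      · left
        have h := G.isHermitian_adjMatrix_real.dotProduct_mulVec_comm (fun _ => 1) (w k)
        rw [hw, hone] at h
        simp only [dotProduct, Pi.smul_apply, smul_eq_mul, one_mul, ← Finset.mul_sum] at h
        rw [mul_right_cancel₀ h0 h, abs_of_nonneg ha]
    rw [← sq_abs]
    rcases hor with h | h <;> rw [h] <;> ring
  have hsum : ∑ k, (l k ^ 2 - (a + s) * |l k| + a * s) = 0 := Finset.sum_eq_zero fun k _ => hroot k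
  rw [Finset.sum_add_distrib, Finset.sum_sub_distrib, hl2, ← Finset.mul_sum] at hsum
  simp only [hreg, Finset.sum_const, Finset.card_univ, nsmul_eq_mul] at hsum
  have has : a + s ≠ 0 := by positivity
  apply mul_left_cancel₀ has
  linear_combination -hsum - hsq

theorem mem_nontrivialEigenvalues_of_mulVec_ne {a s σ : ℝ}
    (hreg : ∀ i, (G.degree i : ℝ) = a) (hσ : σ ^ 2 = s ^ 2) {c : ℝ}
    (hform : ∀ x y : V → ℝ, (G.adjMatrix ℝ *ᵥ x) ⬝ᵥ (G.adjMatrix ℝ *ᵥ y) =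
        s ^ 2 * (x ⬝ᵥ y) + c * ((∑ i, x i) * ∑ i, y i))
    {v : V → ℝ} (hv : ∑ i, v i = 0) (hne : G.adjMatrix ℝ *ᵥ v ≠ σ • v) :
    -σ ∈ G.nontrivialEigenvalues := by
  have hA := G.isHermitian_adjMatrix_real
  have hAA : G.adjMatrix ℝ *ᵥ (G.adjMatrix ℝ *ᵥ v) = s ^ 2 • v := by
    funext i
    have h := hform (Pi.single i 1) v
    rw [← hA.dotProduct_mulVec_comm, hv, mul_zero, mul_zero, add_zero, single_one_dotProduct,
      single_one_dotProduct] at h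
    simpa using h
  have hone : (G.adjMatrix ℝ) *ᵥ (fun _ => 1) = fun _ => a := by
    funext i; rw [adjMatrix_mulVec_one, hreg]
  refine ⟨G.adjMatrix ℝ *ᵥ v - σ • v, sub_ne_zero.2 hne, ?_, ?_⟩
  · have h := hA.dotProduct_mulVec_comm (fun _ => 1) v
    rw [hone] at h
    simp only [dotProduct, one_mul, ← Finset.mul_sum, hv, mul_zero] at h
    simp only [Pi.sub_apply, Pi.smul_apply, smul_eq_mul, Finset.sum_sub_distrib, ← Finset.mul_sum,
      hv, h, mul_zero, sub_zero]
  · rw [mulVec_sub, mulVec_smul, hAA, ← hσ]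
    funext i
    simp
    ring

/-- A regular graph whose squared adjacency matrix is `s ^ 2 I + c J` is complete or strongly
regular with non-trivial eigenvalues `s` and `-s`. -/
theorem eq_top_or_isStronglyRegular_of_form [Nonempty V] {a s c : ℝ}
    (hreg : ∀ i, (G.degree i : ℝ) = a) (ha : 0 < a) (hs : 0 < s)
    (hform : ∀ x y : V → ℝ, (G.adjMatrix ℝ *ᵥ x) ⬝ᵥ (G.adjMatrix ℝ *ᵥ y) =
        s ^ 2 * (x ⬝ᵥ y) + c * ((∑ i, x i) * ∑ i, y i)) :
    G = ⊤ ∨ (G.IsStronglyRegular ∧ G.nontrivialEigenvalues = {s, -s}) := by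
  by_cases htop : G = ⊤
  · exact Or.inl htop
  refine Or.inr ⟨⟨htop, ?_, ?_⟩, ?_⟩
  · rintro rfl
    obtain ⟨v⟩ := ‹Nonempty V›
    have h0 : (⊥ : SimpleGraph V).degree v = 0 := by
      rw [← card_neighborFinset_eq_degree, Finset.card_eq_zero]
      ext u; simp
    have := hreg v
    rw [h0, Nat.cast_zero] at this
    exact ha.ne this
  · have hcommon : ∀ i j, i ≠ j → Fintype.card (G.commonNeighbors i j) = ⌊c⌋₊ := by
      intro i j hij
      have h := hform (Pi.single i 1) (Pi.single j 1)
      have hc : ((Fintype.card (G.commonNeighbors i j) : ℕ) : ℝ) = c := by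
        have e1 : (G.adjMatrix ℝ *ᵥ Pi.single i 1) ⬝ᵥ (G.adjMatrix ℝ *ᵥ Pi.single j 1) =
            ((Fintype.card (G.commonNeighbors i j) : ℕ) : ℝ) := by
          rw [← Set.toFinset_card]
          simp only [dotProduct, mulVec_single_one, col_apply, adjMatrix_apply, ← ite_and,
            mul_ite, mul_one, mul_zero, Finset.sum_boole]
          congr 2
          ext v
          simp [mem_commonNeighbors, G.adj_comm, and_comm]
        rw [← e1, h]
        simp [hij]
      rw [← hc, Nat.floor_natCast]
    obtain ⟨v⟩ := ‹Nonempty V›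
    refine ⟨G.degree v, ⌊c⌋₊, ⌊c⌋₊, rfl, fun u => ?_, fun u w h => hcommon u w h.ne,
      fun u w h _ => hcommon u w h⟩
    exact_mod_cast (hreg u).trans (hreg v).symm
  · have hsum : ∀ i j : V, ∑ k, (Pi.single i 1 - Pi.single j 1 : V → ℝ) k = 0 := by
      intro i j; simp [Finset.sum_sub_distrib]
    have happ : ∀ i j : V, i ≠ j → ∀ σ : ℝ,
        G.adjMatrix ℝ *ᵥ (Pi.single i 1 - Pi.single j 1) = σ • (Pi.single i 1 - Pi.single j 1) →
        G.adjMatrix ℝ i j = -σ := by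
      intro i j hij σ h
      have := congrFun h i
      simp [hij] at this
      simp only [adjMatrix_apply]
      linarith
    obtain ⟨i, j, hij, hadj⟩ : ∃ i j, i ≠ j ∧ ¬ G.Adj i j := by
      by_contra! h
      exact htop (by ext i j; exact ⟨fun h => h.ne, h i j⟩)
    ext t
    simp only [Set.mem_insert_iff, Set.mem_singleton_iff]
    constructor
    · rintro ⟨v, hv0, hv, hvt⟩
      have h := hform v v
      rw [hvt, hv, smul_dotProduct, dotProduct_smul, smul_eq_mul, smul_eq_mul] at h
      have hvv : v ⬝ᵥ v ≠ 0 := fun h => hv0 (dotProduct_self_eq_zero.1 h)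
      refine sq_eq_sq_iff_eq_or_eq_neg.1 (mul_right_cancel₀ hvv ?_)
      linear_combination h
    · rintro (rfl | rfl)
      · rw [← neg_neg t]
        refine G.mem_nontrivialEigenvalues_of_mulVec_ne hreg (by ring) hform (hsum i j)
          fun h => ?_
        have := happ i j hij _ h
        rw [adjMatrix_apply, if_neg hadj] at this
        linarith
      · refine G.mem_nontrivialEigenvalues_of_mulVec_ne hreg rfl hform (hsum i j) fun h => ?_
        have := happ i j hij _ h
        rw [adjMatrix_apply, if_neg hadj] at this
        linarith

theorem extEnergy_eq_energy_of_regular {a : ℝ} (ha : a ≠ 0) (hreg : ∀ i, (G.degree i : ℝ) = a) :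
    G.extEnergy = G.energy := by
  unfold extEnergy energy
  rw [Matrix.IsHermitian.eigenvalues_congr G.extAdjMatrix_isHermitian
    G.isHermitian_adjMatrix_real ?_]
  ext i j
  simp only [extAdjMatrix, of_apply, adjMatrix_apply, hreg, div_self ha]
  norm_num

theorem abs_eq_one_of_iso_disjointCopies {V : Type*} [Fintype V] (G : SimpleGraph V) [DecidableRel G.Adj]
    {m : ℕ}
    (φ : G ≃g disjointCopies m (⊤ : SimpleGraph (Fin 2))) :
    (∀ i, G.degree i = 1) ∧ ∀ t ∈ G.nontrivialEigenvalues, |t| = 1 := by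
  set σ : V → V := fun v => φ.symm ((φ v).1, 1 - (φ v).2) with hσ
  have hfin : ∀ x y : Fin 2, x ≠ y ↔ y = 1 - x := by decide
  have hfin' : ∀ x : Fin 2, 1 - (1 - x) = x := by decide
  have hadj : ∀ u v, G.Adj u v ↔ v = σ u := by
    intro u v
    have h1 : φ (σ u) = ((φ u).1, 1 - (φ u).2) := φ.apply_symm_apply _
    rw [← φ.map_adj_iff, ← φ.injective.eq_iff, h1, Prod.ext_iff, ← hfin, eq_comm (a := (φ v).1)]
    rfl
  have hσσ : ∀ v, σ (σ v) = v := by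
    intro v
    simp [hσ, hfin']
  have hnb : ∀ v, G.neighborFinset v = {σ v} := by
    intro v; ext u; simp [hadj]
  refine ⟨fun i => by rw [← card_neighborFinset_eq_degree, hnb, Finset.card_singleton], ?_⟩
  rintro t ⟨v, hv0, -, hvt⟩
  have h : ∀ i, v (σ i) = t * v i := by
    intro i
    have := congrFun hvt i
    rwa [adjMatrix_mulVec_apply, hnb, Finset.sum_singleton] at this
  obtain ⟨i, hi⟩ := Function.ne_iff.1 hv0
  have h2 : t ^ 2 * v i = 1 * v i := by
    have := h (σ i)
    rw [hσσ, h] at this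
    linear_combination -this
  have := mul_right_cancel₀ hi h2
  rw [← sq_abs] at this
  exact (pow_eq_one_iff_of_nonneg (abs_nonneg t) two_ne_zero).1 this

theorem abs_eq_one_of_eq_top (h : G = ⊤) :
    (∀ i, G.degree i = Fintype.card V - 1) ∧ ∀ t ∈ G.nontrivialEigenvalues, |t| = 1 := by
  subst h
  refine ⟨fun i => by rw [← complete_graph_degree i]; congr!, ?_⟩
  rintro t ⟨v, hv0, hv, hvt⟩
  obtain ⟨i, hi⟩ := Function.ne_iff.1 hv0
  have h := congrFun hvt i
  rw [adjMatrix_mulVec_apply] at h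
  have hnb : (⊤ : SimpleGraph V).neighborFinset i = Finset.univ.erase i := by
    ext u; simp [eq_comm]
  have h2 := Finset.add_sum_erase Finset.univ v (Finset.mem_univ i)
  have h3 : ∑ u ∈ (⊤ : SimpleGraph V).neighborFinset i, v u = ∑ u ∈ Finset.univ.erase i, v u := by
    rw [← hnb]
  have h4 : t * v i = -1 * v i := by
    have : (t • v) i = t * v i := rfl
    linarith
  rw [mul_right_cancel₀ hi h4]; simp

end SimpleGraph

end

theorem mainTheorem8 {V : Type*} [Fintype V] [DecidableEq V] (G : SimpleGraph V)
    [DecidableRel G.Adj] (n e : ℕ) (hn : Fintype.card V = n) (he : G.edgeFinset.card = e)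
    (hmin : G.minDegree ≠ 0) (hne : n ≤ 2 * e) :
    G.extEnergy ≤
        (1 / 2 : ℝ) * ((G.maxDegree : ℝ) / (G.minDegree : ℝ)
            + (G.minDegree : ℝ) / (G.maxDegree : ℝ)) *
          (2 * (e : ℝ) / (n : ℝ)
            + Real.sqrt (((n : ℝ) - 1) * (2 * (e : ℝ) - (2 * (e : ℝ) / (n : ℝ)) ^ 2))) ∧
    (G.extEnergy =
        (1 / 2 : ℝ) * ((G.maxDegree : ℝ) / (G.minDegree : ℝ)
            + (G.minDegree : ℝ) / (G.maxDegree : ℝ)) *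
          (2 * (e : ℝ) / (n : ℝ)
            + Real.sqrt (((n : ℝ) - 1) * (2 * (e : ℝ) - (2 * (e : ℝ) / (n : ℝ)) ^ 2))) ↔
      (Even n ∧
          Nonempty (G ≃g SimpleGraph.disjointCopies (n / 2) (⊤ : SimpleGraph (Fin 2)))) ∨
        Nonempty (G ≃g (⊤ : SimpleGraph (Fin n))) ∨
        (G.IsStronglyRegular ∧
          G.nontrivialEigenvalues =
            {Real.sqrt ((2 * (e : ℝ) - (2 * (e : ℝ) / (n : ℝ)) ^ 2) / ((n : ℝ) - 1)),
              -Real.sqrt ((2 * (e : ℝ) - (2 * (e : ℝ) / (n : ℝ)) ^ 2) / ((n : ℝ) - 1))})) := by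
  have hVne : Nonempty V := by
    by_contra h
    rw [not_nonempty_iff] at h
    exact hmin (by simp)
  obtain ⟨v₀⟩ := id hVne
  have hdpos : ∀ v, 0 < G.degree v := fun v =>
    (Nat.pos_of_ne_zero hmin).trans_le (G.minDegree_le_degree v)
  have hn2 : 1 < n := by
    rw [← hn]
    exact (Nat.succ_le_of_lt (hdpos v₀)).trans_lt (G.degree_lt_card_verts v₀)
  have hn1 : (0 : ℝ) < (n : ℝ) - 1 := by
    have : (1 : ℝ) < n := by exact_mod_cast hn2
    linarith
  have hn0 : (0 : ℝ) < n := by linarith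
  set a : ℝ := 2 * (e : ℝ) / (n : ℝ) with ha
  have h2e : 2 * (e : ℝ) = n * a := by rw [ha]; field_simp
  have hsum : ∑ i, (G.degree i : ℝ) = Fintype.card V * a := by
    rw [hn, ← h2e, ← he]
    exact_mod_cast G.sum_degrees_eq_twice_card_edges
  have ha1 : 1 ≤ a := by
    rw [ha, le_div_iff₀ hn0, one_mul]; exact_mod_cast hne
  have han : a < n := by
    have h : ∑ i, (G.degree i : ℝ) < ∑ _i : V, (n : ℝ) :=
      Finset.sum_lt_sum_of_nonempty Finset.univ_nonempty fun i _ => by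
        rw [← hn]; exact_mod_cast G.degree_lt_card_verts i
    rw [hsum, Finset.sum_const, Finset.card_univ, nsmul_eq_mul, hn] at h
    exact lt_of_mul_lt_mul_left h hn0.le
  rw [h2e]
  set s : ℝ := Real.sqrt ((n * a - a ^ 2) / ((n : ℝ) - 1)) with hs
  have hpos : 0 < (n * a - a ^ 2) / ((n : ℝ) - 1) := by
    refine div_pos ?_ hn1
    nlinarith
  have hs0 : 0 < s := Real.sqrt_pos.2 hpos
  have hs2 : ((n : ℝ) - 1) * s ^ 2 = n * a - a ^ 2 := by
    rw [hs, Real.sq_sqrt hpos.le]; field_simp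
  have hsa : s ≤ a := by
    rw [hs]
    refine Real.sqrt_le_iff.2 ⟨by linarith, ?_⟩
    rw [div_le_iff₀ hn1]
    nlinarith [mul_nonneg hn0.le (mul_nonneg (by linarith : 0 ≤ a) (by linarith : 0 ≤ a - 1))]
  have hsq : Real.sqrt (((n : ℝ) - 1) * (n * a - a ^ 2)) = (n - 1) * s := by
    rw [← hs2, ← Real.sqrt_sq (mul_nonneg hn1.le hs0.le)]
    congr 1; ring
  rw [hsq]
  have hs2' : ((Fintype.card V : ℝ) - 1) * s ^ 2 = Fintype.card V * a - a ^ 2 := by rw [hn, hs2]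
  obtain ⟨hle, heq⟩ := G.energy_le_and_eq_imp hsum hs0 hsa hs2'
  have hext := G.extEnergy_le_mul_energy hmin
  have hconv : (∀ i j, G.degree i = G.degree j) → (∀ t ∈ G.nontrivialEigenvalues, |t| = s) →
      G.extEnergy = (1 / 2 : ℝ) * ((G.maxDegree : ℝ) / (G.minDegree : ℝ)
            + (G.minDegree : ℝ) / (G.maxDegree : ℝ)) * (a + (n - 1) * s) := by
    intro hreg ht
    have hrega : ∀ i, (G.degree i : ℝ) = a := by
      intro i
      have h := hsum
      rw [Finset.sum_congr rfl fun j _ => congrArg Nat.cast (hreg j i), Finset.sum_const,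
        Finset.card_univ, nsmul_eq_mul, hn] at h
      exact mul_left_cancel₀ hn0.ne' h
    obtain ⟨i, hi⟩ := G.exists_minimal_degree_vertex
    obtain ⟨j, hj⟩ := G.exists_maximal_degree_vertex
    have ha0 : a ≠ 0 := by positivity
    rw [G.extEnergy_eq_energy_of_regular ha0 hrega,
      G.energy_eq_of_nontrivialEigenvalues hrega hs0 (by linarith) hs2' ht, hi, hj, hrega, hrega,
      div_self ha0, hn]
    ring
  have hs1 : a = 1 ∨ a = n - 1 → s = 1 := by
    intro h
    rw [hs, show ((n : ℝ) * a - a ^ 2) / (n - 1) = 1 by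
      rw [div_eq_one_iff_eq hn1.ne']
      rcases h with h | h <;> rw [h] <;> ring, Real.sqrt_one]
  have haconst : ∀ d : ℕ, (∀ i, G.degree i = d) → a = d := by
    intro d hd
    have h := hsum
    simp only [hd, Finset.sum_const, Finset.card_univ, nsmul_eq_mul, hn] at h
    exact (mul_left_cancel₀ hn0.ne' h).symm
  set c := (1 / 2 : ℝ) * ((G.maxDegree : ℝ) / (G.minDegree : ℝ)
            + (G.minDegree : ℝ) / (G.maxDegree : ℝ)) with hc
  have hm0 : (0 : ℝ) < G.minDegree := by exact_mod_cast Nat.pos_of_ne_zero hmin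
  have hM0 : (0 : ℝ) < G.maxDegree := by
    exact_mod_cast (hdpos v₀).trans_le (G.degree_le_maxDegree v₀)
  have hc0 : 0 < c := by positivity
  rw [hn] at hle heq
  have hmul := mul_le_mul_of_nonneg_left hle hc0.le
  refine ⟨hext.trans hmul, fun h => ?_, ?_⟩
  · have hE : G.energy = a + (n - 1) * s :=
      mul_left_cancel₀ hc0.ne' (le_antisymm hmul (h ▸ hext))
    obtain ⟨hreg, hform⟩ := heq hE
    rcases G.eq_top_or_isStronglyRegular_of_form hreg (by linarith) hs0 hform with h | h
    · subst h
      exact Or.inr (Or.inl ⟨SimpleGraph.Iso.completeGraph (Fintype.equivFinOfCardEq hn)⟩)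
    · exact Or.inr (Or.inr h)
  · rintro (⟨-, ⟨φ⟩⟩ | ⟨⟨φ⟩⟩ | ⟨⟨-, -, k, l, m, hsrg⟩, hset⟩)
    · obtain ⟨hd, ht⟩ := G.abs_eq_one_of_iso_disjointCopies φ
      refine hconv (fun i j => by rw [hd, hd]) ?_
      rw [hs1 (Or.inl (by simpa using haconst 1 hd))]
      exact ht
    · have htop : G = ⊤ := by
        ext i j
        rw [← φ.map_adj_iff, SimpleGraph.top_adj, SimpleGraph.top_adj, φ.injective.ne_iff]
      obtain ⟨hd, ht⟩ := G.abs_eq_one_of_eq_top htop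
      refine hconv (fun i j => by rw [hd, hd]) ?_
      have := haconst _ hd
      rw [hn, Nat.cast_sub hn2.le, Nat.cast_one] at this
      rw [hs1 (Or.inr this)]
      exact ht
    · refine hconv (fun i j => by rw [hsrg.regular.degree_eq, hsrg.regular.degree_eq]) ?_
      rw [hset]
      rintro t (rfl | rfl)
      · exact abs_of_pos hs0
      · rw [abs_neg]; exact abs_of_pos hs0
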